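/- For a symmetric matrix $K\in\mathbb R^{N\times N}$, let $G_K$ be the simple graph on $[N]=\{1,\dots,N\}$ in which distinct $i,j$ are adjacent if and only if $K_{i,j}\neq 0$. For $S\subseteq[N]$, the principal minor $\Delta_S(K)$ is the determinant of the submatrix of $K$ with rows and columns indexed by $S$; its size is $|S|$. Let $\mathcal D_N$ be the set of $N\times N$ diagonal matrices whose diagonal entries are all $1$ or $-1$. For a graph $G=([N],E)$, the cycle space of $G$ is the subspace of $\mathbb F_2^{E}$ spanned by the incidence vectors of the edge sets of all connected subgraphs of $G$ in which every vertex has even degree. The cycle sparsity of $G$ is the least integer $s$ for which the cycle space of $G$ has a basis consisting of incidence vectors of induced (that is, chordless) simple cycles of $G$ of length at most $s$, with the convention that it equals $2$ if the cycle space is trivial. Proposition. Let $K\in\mathbb R^{N\times N}$ be a symmetric matrix and let $\ell\ge 3$ be an integer. Then $K$ is determined up to $\mathcal D_N$-similarity by its principal minors of size at most $\ell$, meaning that every symmetric matrix $K'\in\mathbb R^{N\times N}$ with $\Delta_S(K')=\Delta_S(K)$ for all $S\subseteq[N]$ with $|S|\le\ell$ is of the form $K'=DKD$ for some $D\in\mathcal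 D_N$, if and only if the cycle sparsity of $G_K$ is at most $\ell$. -/

import Mathlib

noncomputable section

namespace CycleSparsity

variable {N : ℕ}

/-- The graph induced by a (symmetric) matrix `K`: distinct `i`, `j` are adjacent when the
corresponding off-diagonal entry is nonzero. -/
def inducedGraph (K : Matrix (Fin N) (Fin N) ℝ) : SimpleGraph (Fin N) :=
  SimpleGraph.fromRel fun i j => K i j ≠ 0

/-- The principal minor of `K` indexed by `S`. -/
def principalMinor (K : Matrix (Fin N) (Fin N) ℝ) (S : Finset (Fin N)) : ℝ :=
  (K.submatrix (Subtype.val : S → Fin N) (Subtype.val : S → Fin N)).det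

/-- The diagonal matrices all of whose diagonal entries are `1` or `-1`. -/
def signDiagonals (N : ℕ) : Set (Matrix (Fin N) (Fin N) ℝ) :=
  {D | ∃ d : Fin N → ℝ, (∀ i, d i = 1 ∨ d i = -1) ∧ D = Matrix.diagonal d}

/-- `K'` arises from `K` by flipping the signs of some rows and of the same columns. -/
def SignSimilar (K K' : Matrix (Fin N) (Fin N) ℝ) : Prop :=
  ∃ D ∈ signDiagonals N, K' = D * K * D

/-- Among all symmetric real matrices, `K` is determined up to sign similarity by its principal
minors of size at most `l`. -/
def DeterminedByMinors (K : Matrix (Fin N) (Fin N) ℝ) (l : ℕ) : Prop :=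
  ∀ K' : Matrix (Fin N) (Fin N) ℝ, K'.IsSymm →
    (∀ S : Finset (Fin N), S.card ≤ l → principalMinor K' S = principalMinor K S) →
      SignSimilar K K'

/-- A cycle in the wide sense: a connected subgraph in which each vertex has even degree. -/
def IsEvenSubgraph {G : SimpleGraph (Fin N)} (H : G.Subgraph) : Prop :=
  H.Connected ∧ ∀ v, Even (H.neighborSet v).ncard

open Classical in
/-- The incidence vector over the field with two elements of the edges of a subgraph. -/
def incidenceVector {G : SimpleGraph (Fin N)} (H : G.Subgraph) : G.edgeSet → ZMod 2 :=
  fun e => if (e : Sym2 (Fin N)) ∈ H.edgeSet then 1 else 0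

/-- The cycle space of `G`. -/
def cycleSpace (G : SimpleGraph (Fin N)) : Submodule (ZMod 2) (G.edgeSet → ZMod 2) :=
  Submodule.span (ZMod 2) {x | ∃ H : G.Subgraph, IsEvenSubgraph H ∧ x = incidenceVector H}

/-- `x` is the incidence vector of an induced (chordless) simple cycle of length at most `l`. -/
def IsInducedCycleVector (G : SimpleGraph (Fin N)) (l : ℕ) (x : G.edgeSet → ZMod 2) : Prop :=
  ∃ (v : Fin N) (p : G.Walk v v), p.IsCycle ∧ p.toSubgraph.IsInduced ∧ p.length ≤ l ∧
    x = incidenceVector p.toSubgraph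

/-- `G` admits a basis of its cycle space made of induced simple cycles of length at most `l`. -/
def HasInducedCycleBasis (G : SimpleGraph (Fin N)) (l : ℕ) : Prop :=
  ∃ B : Set (G.edgeSet → ZMod 2),
    (∀ x ∈ B, IsInducedCycleVector G l x) ∧
      LinearIndepOn (ZMod 2) id B ∧ Submodule.span (ZMod 2) B = cycleSpace G

open Classical in
/-- The least `l` for which `G` has a basis of its cycle space made of induced cycles of length at
most `l`, with the convention that it is `2` if the cycle space is trivial. -/
def cycleSparsity (G : SimpleGraph (Fin N)) : ℕ∞ :=
  if cycleSpace G = ⊥ then 2 else ⨅ (l : ℕ) (_ : HasInducedCycleBasis G l), (l : ℕ∞)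

end CycleSparsity

end

/-! Minors of size at most 2 fix the diagonal of `K'` and the absolute values of its other entries,
so `K'` differs from `K` by signs: a labelling `y` of the edges over F_2. Sign similarity means that
`y` is a coboundary `d u + d v` on the edges, equivalently that `y`, as a functional on edge
vectors, kills the cycle space.

Small minors see exactly the values of `y` on short induced cycles. An odd sum changes the minor on
the cycle's vertices (`walkSum_eq_zero_of_minor_eq`); conversely, if all induced cycles of length at
most `#S` have sum zero, `y` is a coboundary on `S` and the minor is unchanged
(`principalMinor_eq_of_walkSum_eq_zero`). So `K` is determined iff every functional killing the
short induced cycles kills the cycle space, which by linear duality says that these cycles span it.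
-/

namespace CycleSparsity

open SimpleGraph

/-! ### Edge labellings over F_2, closed walks and potentials -/

section WalkSum

variable {V : Type*} {G : SimpleGraph V}

/-- The sum of the labels of the edges traversed by a walk. -/
def walkSum (y : Sym2 V → ZMod 2) {u v : V} (p : G.Walk u v) : ZMod 2 :=
  (p.edges.map y).sum

@[simp]
theorem walkSum_nil (y : Sym2 V → ZMod 2) (u : V) : walkSum y (Walk.nil : G.Walk u u) = 0 := rfl

@[simp]
theorem walkSum_cons (y : Sym2 V → ZMod 2) {u v w : V} (h : G.Adj u v) (p : G.Walk v w) :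
    walkSum y (p.cons h) = y s(u, v) + walkSum y p := by
  simp [walkSum]

@[simp]
theorem walkSum_append (y : Sym2 V → ZMod 2) {u v w : V} (p : G.Walk u v) (q : G.Walk v w) :
    walkSum y (p.append q) = walkSum y p + walkSum y q := by
  simp [walkSum]

@[simp]
theorem walkSum_reverse (y : Sym2 V → ZMod 2) {u v : V} (p : G.Walk u v) :
    walkSum y p.reverse = walkSum y p := by
  simp [walkSum]

theorem walkSum_rotate [DecidableEq V] (y : Sym2 V → ZMod 2) {u v : V} (p : G.Walk v v)
    (h : u ∈ p.support) : walkSum y (p.rotate u h) = walkSum y p :=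
  ((p.rotate_edges u h).perm.map y).sum_eq

theorem exists_closed_subwalk_of_not_isPath {u v : V} (p : G.Walk u v) (hp : ¬ p.IsPath) :
    ∃ (w : V) (a : G.Walk u w) (b : G.Walk w w) (c : G.Walk w v),
      p = a.append (b.append c) ∧ 0 < b.length := by
  classical
  induction p with
  | nil => simp at hp
  | @cons u w v h q ih =>
    by_cases hq : q.IsPath
    · have hu : u ∈ q.support := by
        by_contra hu
        exact hp ((Walk.cons_isPath_iff h q).2 ⟨hq, hu⟩)
      exact ⟨u, .nil, .cons h (q.takeUntil u hu), q.dropUntil u hu, by simp, by simp⟩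
    · obtain ⟨x, a, b, c, rfl, hb⟩ := ih hq
      exact ⟨x, .cons h a, b, c, by simp, hb⟩

theorem walkSum_eq_zero_of_length_lt_three (y : Sym2 V → ZMod 2) {v : V} (p : G.Walk v v)
    (hp : p.length < 3) : walkSum y p = 0 := by
  match p, hp with
  | .nil, _ => rfl
  | .cons h .nil, _ => exact absurd rfl h.ne
  | .cons (v := w) h (.cons h' .nil), _ =>
    simp [Sym2.eq_swap (a := w) (b := v), CharTwo.add_self_eq_zero]
  | .cons _ (.cons _ (.cons _ _)), hp => simp at hp; omega

/-- A labelling that vanishes on induced cycles vanishes on all closed walks. -/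
theorem walkSum_eq_zero_of_induced_cycles (y : Sym2 V → ZMod 2)
    (hy : ∀ (v : V) (p : G.Walk v v), p.IsCycle → p.toSubgraph.IsInduced → walkSum y p = 0)
    (v : V) (p : G.Walk v v) : walkSum y p = 0 := by
  classical
  induction hn : p.length using Nat.strong_induction_on generalizing v p with
  | _ n ih =>
    subst hn
    by_contra h0
    have h3 : 3 ≤ p.length := by
      by_contra h3
      exact h0 (walkSum_eq_zero_of_length_lt_three y p (by omega))
    have hcyc : p.IsCycle := by
      rw [Walk.isCycle_iff_isPath_tail_and_le_length]
      refine ⟨?_, h3⟩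
      cases p with
      | nil => simp at h3
      | cons h q =>
        -- A repeated vertex would split the walk into two shorter closed walks, both with sum zero
        -- by induction.
        by_contra hq
        obtain ⟨w, a, b, c, rfl, hb⟩ := exists_closed_subwalk_of_not_isPath q (by simpa using hq)
        have h1 := ih _ (by simp; omega) _ b rfl
        have h2 := ih _ (by simp; omega) _ (.cons h (a.append c)) rfl
        apply h0
        simp only [walkSum_cons, walkSum_append] at h2 ⊢
        rw [h1, zero_add, h2]
    refine h0 (hy v p hcyc ?_)
    intro u hu w hw huw
    rw [Walk.mem_verts_toSubgraph] at hu hw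
    rw [Walk.adj_toSubgraph_iff_mem_edges, ← (p.rotate_edges u hu).mem_iff]
    have hr : walkSum y (p.rotate u hu) ≠ 0 := by rwa [walkSum_rotate]
    have hl := p.length_rotate u hu
    have hw' : w ∈ (p.rotate u hu).support := by simpa using hw
    generalize p.rotate u hu = q at hr hl hw'
    rw [← q.take_spec hw'] at hr hl ⊢
    generalize q.takeUntil w hw' = a at *
    generalize q.dropUntil w hw' = b at *
    rw [Walk.length_append] at hl
    have key : ∀ a : G.Walk u w, a.length ≤ 1 → s(u, w) ∈ a.edges := by
      intro a ha
      match a, ha with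
      | .nil, _ => exact absurd rfl huw.ne
      | .cons _ .nil, _ => simp
      | .cons _ (.cons _ _), ha => simp at ha
    rw [Walk.edges_append, List.mem_append]
    by_cases ha : a.length ≤ 1
    · exact .inl (key a ha)
    by_cases hb : b.length ≤ 1
    · right
      simpa using key b.reverse (by simpa using hb)
    exfalso
    -- A chord closes each of the two arcs into a shorter closed walk. Its label is counted twice,
    -- so it cancels.
    have h1 := ih _ (by simp; omega) _ (Walk.cons huw.symm a) rfl
    have h2 := ih _ (by simp; omega) _ (Walk.cons huw b) rfl
    apply hr
    rw [walkSum_cons] at h1 h2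
    rw [walkSum_append]
    have h3 : y s(w, u) = y s(u, w) := by rw [Sym2.eq_swap]
    rw [h3] at h1
    linear_combination h1 + h2 - CharTwo.add_self_eq_zero (y s(u, w))

/-- A labelling that vanishes on closed walks is a coboundary. -/
theorem exists_potential (y : Sym2 V → ZMod 2)
    (hy : ∀ (v : V) (p : G.Walk v v), walkSum y p = 0) :
    ∃ d : V → ZMod 2, ∀ u v, G.Adj u v → y s(u, v) = d u + d v := by
  -- The potential is the sum along a chosen walk from a base point of the component.
  have hr : ∀ v, G.Reachable (G.connectedComponentMk v).out v := fun v =>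
    ConnectedComponent.exact (Quot.out_eq (G.connectedComponentMk v))
  let P := fun v => (hr v).some
  refine ⟨fun v => walkSum y (P v), fun u v huv => ?_⟩
  have hc : (G.connectedComponentMk v).out = (G.connectedComponentMk u).out := by
    rw [ConnectedComponent.sound huv.reachable]
  have h : walkSum y (((P u).append (.cons huv (P v).reverse)).copy rfl hc) = 0 := hy _ _
  have h' : walkSum y (((P u).append (.cons huv (P v).reverse)).copy rfl hc)
      = walkSum y ((P u).append (.cons huv (P v).reverse)) := by
    simp [walkSum]
  rw [h', walkSum_append, walkSum_cons, walkSum_reverse] at h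
  linear_combination h - CharTwo.add_self_eq_zero (walkSum y (P u))
    - CharTwo.add_self_eq_zero (walkSum y (P v))

/-- On vertices contained in `S`, a labelling vanishing on all induced cycles of length at most
`#S` is a coboundary. -/
theorem exists_potential_on [DecidableEq V] (y : Sym2 V → ZMod 2) (S : Finset V)
    (hy : ∀ (v : V) (p : G.Walk v v), p.IsCycle → p.toSubgraph.IsInduced → p.length ≤ S.card →
      walkSum y p = 0) :
    ∃ d : V → ZMod 2, ∀ u ∈ S, ∀ v ∈ S, G.Adj u v → y s(u, v) = d u + d v := by
  -- `H` keeps only the edges inside `S`. Every vertex of a cycle of `H` has a neighbour, hence lies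
  -- in `S`, so induced cycles of `H` stay induced in `G`.
  let H : SimpleGraph V :=
    { Adj := fun u v => G.Adj u v ∧ u ∈ S ∧ v ∈ S
      symm := ⟨fun u v h => ⟨h.1.symm, h.2.2, h.2.1⟩⟩
      loopless := ⟨fun u h => h.1.ne rfl⟩ }
  have hle : H ≤ G := fun u v h => h.1
  have hsum : ∀ (v : V) (p : H.Walk v v), walkSum y p = 0 := by
    refine walkSum_eq_zero_of_induced_cycles y fun v p hp hind => ?_
    have hS : ∀ w ∈ p.support, w ∈ S := by
      intro w hw
      have h2 := hp.ncard_neighborSet_toSubgraph_eq_two hw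
      obtain ⟨x, hx⟩ := Set.nonempty_of_ncard_ne_zero (h2 ▸ two_ne_zero)
      exact (p.toSubgraph.adj_sub hx).2.1
    have hsum : walkSum y (p.mapLe hle) = walkSum y p := by
      simp only [walkSum, Walk.edges_mapLe_eq_edges]
    rw [← hsum]
    refine hy v _ (hp.mapLe hle) ?_ ?_
    · intro u hu w hw huw
      rw [Walk.mem_verts_toSubgraph, Walk.support_mapLe_eq_support] at hu hw
      rw [Walk.adj_toSubgraph_mapLe]
      exact hind ((p.mem_verts_toSubgraph).2 hu) ((p.mem_verts_toSubgraph).2 hw)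
        ⟨huw, hS _ hu, hS _ hw⟩
    · rw [Walk.length_mapLe]
      have hcard : p.support.tail.toFinset.card = p.length := by
        rw [List.toFinset_card_of_nodup hp.support_nodup]
        simp
      rw [← hcard]
      exact Finset.card_le_card fun w hw =>
        hS w (List.mem_of_mem_tail (List.mem_toFinset.1 hw))
  obtain ⟨d, hd⟩ := exists_potential y hsum
  exact ⟨d, fun u hu v hv h => hd u v ⟨h, hu, hv⟩⟩

end WalkSum

/-! ### Determinants of matrices supported on a cycle -/

/-- The effect on the determinant of changing two symmetric entries. -/
theorem det_add_single_add_single {n : Type*} [Fintype n] [DecidableEq n] {R : Type*} [CommRing R]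
    (A : Matrix n n R) {a b : n} (hab : a ≠ b) (t : R) :
    (A + Matrix.single a b t + Matrix.single b a t).det =
      A.det + t * (A.adjugate a b + A.adjugate b a) +
        t ^ 2 * ((A.updateRow a (Pi.single b 1)).updateRow b (Pi.single a 1)).det := by
  have hA : A + Matrix.single a b t + Matrix.single b a t =
      (A.updateRow a (A a + t • Pi.single b 1)).updateRow b (A b + t • Pi.single a 1) := by
    ext i j
    by_cases hib : i = b
    · subst hib
      simp [Matrix.single_apply, hab, Pi.single_apply, eq_comm]
    · by_cases hia : i = a
      · subst hia
        simp [Matrix.single_apply, hab.symm, Pi.single_apply, eq_comm]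
      · simp [hia, hib, Ne.symm hia, Ne.symm hib]
  rw [hA, Matrix.det_updateRow_add, Matrix.det_updateRow_smul, Matrix.updateRow_comm _ hab,
    Matrix.updateRow_eq_self, Matrix.det_updateRow_add, Matrix.det_updateRow_smul,
    Matrix.updateRow_eq_self, Matrix.updateRow_comm _ hab, Matrix.det_updateRow_add,
    Matrix.det_updateRow_smul, Matrix.updateRow_comm _ hab.symm, Matrix.updateRow_eq_self,
    Matrix.updateRow_comm _ hab.symm, Matrix.adjugate_apply, Matrix.adjugate_apply]
  ring

/-- The corner of the adjugate of a tridiagonal matrix. -/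
theorem adjugate_corner_ne_zero {m : ℕ} (A : Matrix (Fin (m + 1)) (Fin (m + 1)) ℝ)
    (hzero : ∀ i j : Fin (m + 1), (j : ℕ) + 1 < i → A i j = 0)
    (hne : ∀ i : Fin m, A i.succ i.castSucc ≠ 0) :
    A.adjugate (Fin.last m) 0 ≠ 0 := by
  -- Deleting row `0` and the last column moves the subdiagonal of `A` onto the diagonal, with zeros
  -- below it.
  rw [Matrix.adjugate_fin_succ_eq_det_submatrix, Matrix.det_of_isUpperTriangular]
  · refine mul_ne_zero (pow_ne_zero _ (by norm_num)) (Finset.prod_ne_zero_iff.2 fun i _ => ?_)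
    simpa using hne i
  · intro i j hij
    have hij' : (j : ℕ) < i := hij
    simpa using hzero i.succ j.castSucc (by simpa using hij')

/-- Flipping the sign of one edge of a cycle changes the determinant. -/
theorem det_ne_of_corner_flipped {m : ℕ} (hm : 2 ≤ m)
    (A B : Matrix (Fin (m + 1)) (Fin (m + 1)) ℝ) (hA : A.IsSymm) (hB : B.IsSymm)
    (hAB : ∀ i j : Fin (m + 1), i ≤ j → (i = 0 → j ≠ Fin.last m) → B i j = A i j)
    (hcorner : B 0 (Fin.last m) = - A 0 (Fin.last m)) (hcorner_ne : A 0 (Fin.last m) ≠ 0)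
    (hzero : ∀ i j : Fin (m + 1), (i : ℕ) + 1 < j → (i = 0 → j ≠ Fin.last m) → A i j = 0)
    (hne : ∀ i : Fin m, A i.castSucc i.succ ≠ 0) :
    B.det ≠ A.det := by
  have h0 : (0 : Fin (m + 1)) ≠ Fin.last m := by
    intro h
    have := congrArg Fin.val h
    simp at this
    omega
  set t := A 0 (Fin.last m) with ht
  -- `M` is `A` with both corners erased; `A` and `B` restore them as `t` and `-t`. The quadratic
  -- terms of the determinants agree, so only the linear term, a corner of the adjugate, matters.
  set M := A + Matrix.single 0 (Fin.last m) (-t) + Matrix.single (Fin.last m) 0 (-t) with hM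
  have hMs : M.IsSymm := by
    ext i j
    simp only [hM, Matrix.transpose_apply, Matrix.add_apply, Matrix.single_apply, hA.apply i j,
      and_comm]
    ring
  have hM0 : M 0 (Fin.last m) = 0 := by simp [hM, h0, ← ht]
  have hMA : ∀ i j : Fin (m + 1), i ≤ j → (i = 0 → j ≠ Fin.last m) → M i j = A i j := by
    intro i j hij h
    have h1 : ¬ (0 = i ∧ Fin.last m = j) := fun h' => h h'.1.symm h'.2.symm
    have h2 : ¬ (Fin.last m = i ∧ 0 = j) := by
      rintro ⟨rfl, rfl⟩
      exact h0 (le_antisymm (Fin.zero_le _) hij)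
    simp [hM, h1, h2]
  have hsym_ext : ∀ P Q : Matrix (Fin (m + 1)) (Fin (m + 1)) ℝ, P.IsSymm → Q.IsSymm →
      (∀ i j, i ≤ j → P i j = Q i j) → P = Q := by
    intro P Q hP hQ h
    ext i j
    rcases le_total i j with hij | hij
    · exact h i j hij
    · rw [← hP.apply, ← hQ.apply, h j i hij]
  have hcs : ∀ s : ℝ,
      (M + Matrix.single 0 (Fin.last m) s + Matrix.single (Fin.last m) 0 s).IsSymm := by
    intro s
    ext i j
    simp only [Matrix.transpose_apply, Matrix.add_apply, Matrix.single_apply, hMs.apply i j,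
      and_comm]
    ring
  have hce : ∀ (s : ℝ) (P : Matrix (Fin (m + 1)) (Fin (m + 1)) ℝ), P.IsSymm →
      P 0 (Fin.last m) = s → (∀ i j, i ≤ j → (i = 0 → j ≠ Fin.last m) → P i j = A i j) →
      P = M + Matrix.single 0 (Fin.last m) s + Matrix.single (Fin.last m) 0 s := by
    intro s P hP hs h
    refine hsym_ext _ _ hP (hcs s) fun i j hij => ?_
    by_cases hc : i = 0 ∧ j = Fin.last m
    · obtain ⟨rfl, rfl⟩ := hc
      simp [h0, hM0, hs]
    · have hc' : i = 0 → j ≠ Fin.last m := fun h1 h2 => hc ⟨h1, h2⟩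
      have h1 : ¬ (0 = i ∧ Fin.last m = j) := fun h' => hc' h'.1.symm h'.2.symm
      have h2 : ¬ (Fin.last m = i ∧ 0 = j) := by
        rintro ⟨rfl, rfl⟩
        exact h0 (le_antisymm (Fin.zero_le _) hij)
      simp [h i j hij hc', hMA i j hij hc', h1, h2]
  have eA := hce t A hA rfl fun _ _ _ _ => rfl
  have eB := hce (-t) B hB hcorner hAB
  have hadj : M.adjugate (Fin.last m) 0 ≠ 0 := by
    refine adjugate_corner_ne_zero M (fun i j hij => ?_) (fun i => ?_)
    · rw [← hMs.apply]
      by_cases hc : j = 0 ∧ i = Fin.last m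
      · rw [hc.1, hc.2, hM0]
      · have hc' : j = 0 → i ≠ Fin.last m := fun h1 h2 => hc ⟨h1, h2⟩
        rw [hMA j i (by rw [Fin.le_def]; omega) hc', hzero j i hij hc']
    · rw [← hMs.apply, hMA]
      · exact hne i
      · exact (Fin.castSucc_lt_succ).le
      -- Since `2 ≤ m`, no superdiagonal entry is the corner.
      · intro h1 h2
        have := congrArg Fin.val h1
        have := congrArg Fin.val h2
        simp at *
        omega
  have hadj' : M.adjugate 0 (Fin.last m) = M.adjugate (Fin.last m) 0 := by
    conv_lhs => rw [← hMs, ← Matrix.adjugate_transpose, Matrix.transpose_apply]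
  intro hdet
  rw [eA, eB, det_add_single_add_single M h0, det_add_single_add_single M h0, hadj'] at hdet
  have : t * M.adjugate (Fin.last m) 0 = 0 := by linarith
  exact mul_ne_zero hcorner_ne hadj this

/-! ### Signs and principal minors along induced cycles -/

/-- The sign character of the field with two elements. -/
noncomputable def sgn (a : ZMod 2) : ℝ := if a = 0 then 1 else -1

@[simp]
theorem sgn_zero : sgn 0 = 1 := by simp [sgn]

@[simp]
theorem sgn_one : sgn 1 = -1 := by simp [sgn]

theorem zmod_two_eq_zero_or_one (a : ZMod 2) : a = 0 ∨ a = 1 := by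
  revert a; decide

theorem sgn_eq_one_or (a : ZMod 2) : sgn a = 1 ∨ sgn a = -1 := by
  rcases zmod_two_eq_zero_or_one a with rfl | rfl <;> simp

theorem sgn_mul_self (a : ZMod 2) : sgn a * sgn a = 1 := by
  rcases sgn_eq_one_or a with h | h <;> simp [h]

theorem sgn_add (a b : ZMod 2) : sgn (a + b) = sgn a * sgn b := by
  rcases zmod_two_eq_zero_or_one a with rfl | rfl <;>
    rcases zmod_two_eq_zero_or_one b with rfl | rfl <;> simp [CharTwo.add_self_eq_zero]

theorem sgn_injective : Function.Injective sgn := by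
  intro a b h
  rcases zmod_two_eq_zero_or_one a with rfl | rfl <;>
    rcases zmod_two_eq_zero_or_one b with rfl | rfl <;> first | rfl | norm_num at h

theorem exists_sgn_eq {a : ℝ} (h : a = 1 ∨ a = -1) : ∃ b, sgn b = a := by
  rcases h with rfl | rfl
  · exact ⟨0, sgn_zero⟩
  · exact ⟨1, sgn_one⟩

theorem det_diagonal_conj {n : Type*} [Fintype n] [DecidableEq n] (M : Matrix n n ℝ)
    (s : n → ZMod 2) :
    (Matrix.diagonal (fun i => sgn (s i)) * M * Matrix.diagonal (fun i => sgn (s i))).det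
      = M.det := by
  have h : (∏ i, sgn (s i)) * ∏ i, sgn (s i) = 1 := by
    rw [← Finset.prod_mul_distrib]
    exact Finset.prod_eq_one fun i _ => sgn_mul_self _
  rw [Matrix.det_mul, Matrix.det_mul, Matrix.det_diagonal]
  linear_combination M.det * h

variable {N : ℕ}

theorem inducedGraph_adj {K : Matrix (Fin N) (Fin N) ℝ} (hK : K.IsSymm) {i j : Fin N} :
    (inducedGraph K).Adj i j ↔ i ≠ j ∧ K i j ≠ 0 := by
  rw [inducedGraph, SimpleGraph.fromRel_adj, hK.apply i j, or_self]

theorem principalMinor_image {n : ℕ} (K : Matrix (Fin N) (Fin N) ℝ) (c : Fin n → Fin N)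
    (hc : Function.Injective c) :
    principalMinor K (Finset.univ.image c) = (K.submatrix c c).det := by
  have hb : Function.Bijective
      (fun i => (⟨c i, Finset.mem_image_of_mem c (Finset.mem_univ i)⟩ :
        (Finset.univ.image c : Finset (Fin N)))) := by
    refine ⟨fun i j h => hc (congrArg Subtype.val h), fun ⟨x, hx⟩ => ?_⟩
    obtain ⟨i, -, rfl⟩ := Finset.mem_image.1 hx
    exact ⟨i, rfl⟩
  rw [principalMinor, ← Matrix.det_submatrix_equiv_self (Equiv.ofBijective _ hb)]
  rfl

theorem walkSum_eq_sum_range {V : Type*} {G : SimpleGraph V} (y : Sym2 V → ZMod 2) {u v : V}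
    (p : G.Walk u v) :
    walkSum y p = ∑ k ∈ Finset.range p.length, y s(p.getVert k, p.getVert (k + 1)) := by
  induction p with
  | nil => simp
  | cons h p ih =>
    rw [walkSum_cons, Walk.length_cons, Finset.sum_range_succ', ih]
    simp only [Walk.getVert_cons_succ, Walk.getVert_zero]
    exact add_comm _ _

/-- If two matrices differ only by signs and have the same determinant on the vertices of an
induced cycle, then an even number of signs change along that cycle. -/
theorem walkSum_eq_zero_of_minor_eq {K K' : Matrix (Fin N) (Fin N) ℝ} (hK : K.IsSymm)
    (y : Sym2 (Fin N) → ZMod 2) (hy : ∀ i j, K' i j = sgn (y s(i, j)) * K i j)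
    (hdiag : ∀ i, y s(i, i) = 0) {v : Fin N} (p : (inducedGraph K).Walk v v) (hp : p.IsCycle)
    (hind : p.toSubgraph.IsInduced)
    (hminor : ∀ S : Finset (Fin N), S.card ≤ p.length → principalMinor K' S = principalMinor K S) :
    walkSum y p = 0 := by
  obtain ⟨m, hm⟩ : ∃ m, p.length = m + 1 := ⟨p.length - 1, by have := hp.three_le_length; omega⟩
  have hm2 : 2 ≤ m := by have := hp.three_le_length; omega
  have hinj : ∀ a b, a ≤ m → b ≤ m → p.getVert a = p.getVert b → a = b := fun a b ha hb h =>
    hp.getVert_injOn' (by simp; omega) (by simp; omega) h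
  have hlast : p.getVert (m + 1) = p.getVert 0 := by
    rw [← hm, Walk.getVert_length, Walk.getVert_zero]
  let c : Fin (m + 1) → Fin N := fun i => p.getVert i
  have hc : Function.Injective c := fun i j h => Fin.ext (hinj i j (by omega) (by omega) h)
  -- Conjugating `K'` by the signs of these partial sums undoes the sign changes on all edges but
  -- the closing one, which then carries the whole sum along `p`.
  let s : ℕ → ZMod 2 := fun i => ∑ k ∈ Finset.range i, y s(p.getVert k, p.getVert (k + 1))
  have hs : ∀ k, s (k + 1) = s k + y s(p.getVert k, p.getVert (k + 1)) := fun k =>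
    Finset.sum_range_succ _ _
  have hws : walkSum y p = s (m + 1) := by rw [walkSum_eq_sum_range, hm]
  by_contra hne
  have h1 : walkSum y p = 1 := (zmod_two_eq_zero_or_one _).resolve_left hne
  rw [hws, hs, hlast] at h1
  have hadj : ∀ k ≤ m, K (p.getVert k) (p.getVert (k + 1)) ≠ 0 := fun k hk =>
    ((inducedGraph_adj hK).1 (p.adj_getVert_succ (by omega))).2
  have hzero : ∀ i j : Fin (m + 1), (i : ℕ) + 1 < j → (i = 0 → j ≠ Fin.last m) →
      K (c i) (c j) = 0 := by
    intro i j hij hcor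
    by_contra hK0
    have hA : (inducedGraph K).Adj (c i) (c j) :=
      (inducedGraph_adj hK).2 ⟨fun h => by have := hc h; subst this; omega, hK0⟩
    have hA' := hind ((p.mem_verts_toSubgraph).2 (p.getVert_mem_support i))
      ((p.mem_verts_toSubgraph).2 (p.getVert_mem_support j)) hA
    obtain ⟨k, hk, hkm⟩ := (p.toSubgraph_adj_iff).1 hA'
    have hj := j.2
    rcases Nat.lt_or_ge k m with hlt | hge
    · rcases Sym2.eq_iff.1 hk with ⟨ha, hb⟩ | ⟨ha, hb⟩
      · have := hinj _ _ (by omega) (by omega) ha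
        have := hinj _ _ (by omega) (by omega) hb
        omega
      · have := hinj _ _ (by omega) (by omega) ha
        have := hinj _ _ (by omega) (by omega) hb
        omega
    · have hkm' : k = m := by omega
      subst hkm'
      rw [hlast] at hk
      rcases Sym2.eq_iff.1 hk with ⟨ha, hb⟩ | ⟨ha, hb⟩
      · have := hinj _ _ (by omega) (by omega) ha
        omega
      · have h1 := hinj _ _ (by omega) (by omega) ha
        have h2 := hinj _ _ (by omega) (by omega) hb
        exact hcor (Fin.ext h2.symm) (Fin.ext h1.symm)
  let B : Matrix (Fin (m + 1)) (Fin (m + 1)) ℝ :=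
    Matrix.diagonal (fun i : Fin (m + 1) => sgn (s i)) * K'.submatrix c c *
      Matrix.diagonal (fun i : Fin (m + 1) => sgn (s i))
  have hBapp : ∀ i j : Fin (m + 1),
      B i j = sgn (s i + y s(c i, c j) + s j) * K (c i) (c j) := by
    intro i j
    simp only [B, Matrix.mul_diagonal, Matrix.diagonal_mul, Matrix.submatrix_apply, hy, sgn_add]
    ring
  refine det_ne_of_corner_flipped hm2 (K.submatrix c c) B (hK.submatrix c) ?_ ?_ ?_ ?_ hzero ?_ ?_
  · ext i j
    rw [Matrix.transpose_apply, hBapp, hBapp, hK.apply, Sym2.eq_swap, add_right_comm, add_comm (s j),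
      add_right_comm]
  · intro i j hij hcor
    rw [hBapp, Matrix.submatrix_apply]
    rcases hij.eq_or_lt with rfl | hlt
    · rw [hdiag, add_zero, CharTwo.add_self_eq_zero, sgn_zero, one_mul]
    · rcases Nat.lt_or_ge ((i : ℕ) + 1) j with h | h
      · rw [hzero i j h hcor, mul_zero]
      · have hji : (j : ℕ) = i + 1 := le_antisymm h hlt
        have : s i + y s(c i, c j) + s j = 0 := by
          simp only [c, hji]
          rw [hs, CharTwo.add_self_eq_zero]
        rw [this, sgn_zero, one_mul]
  · rw [hBapp, Matrix.submatrix_apply]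
    have : s (0 : Fin (m + 1)) + y s(c 0, c (Fin.last m)) + s (Fin.last m) = 1 := by
      have h0 : s (0 : Fin (m + 1)) = 0 := by simp [s]
      rw [h0, zero_add, add_comm, Sym2.eq_swap]
      simpa [c] using h1
    rw [this, sgn_one, neg_one_mul]
  · rw [Matrix.submatrix_apply, ← hK.apply]
    have := hadj m le_rfl
    rw [hlast] at this
    simpa [c] using this
  · intro i
    simpa [c] using hadj i (by omega)
  · have hcard : (Finset.univ.image c).card ≤ p.length := by
      rw [Finset.card_image_of_injective _ hc, hm, Finset.card_univ, Fintype.card_fin]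
    rw [det_diagonal_conj, ← principalMinor_image K' c hc, hminor _ hcard,
      principalMinor_image K c hc]

/-! ### Labellings as functionals on the cycle space -/

open Classical in
/-- The linear form on edge vectors given by an edge labelling. -/
noncomputable def pairing (G : SimpleGraph (Fin N)) (y : Sym2 (Fin N) → ZMod 2) :
    (G.edgeSet → ZMod 2) →ₗ[ZMod 2] ZMod 2 :=
  ∑ e : G.edgeSet, y e • LinearMap.proj e

open Classical in
theorem pairing_incidenceVector {G : SimpleGraph (Fin N)} (y : Sym2 (Fin N) → ZMod 2)
    (H : G.Subgraph) (T : Finset (Sym2 (Fin N))) (hT : ∀ e, e ∈ T ↔ e ∈ H.edgeSet) :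
    pairing G y (incidenceVector H) = ∑ e ∈ T, y e := by
  have h1 : pairing G y (incidenceVector H) =
      ∑ e : G.edgeSet, if (e : Sym2 (Fin N)) ∈ H.edgeSet then y e else 0 := by
    simp [pairing, incidenceVector]
  rw [h1, ← Finset.sum_filter]
  refine Finset.sum_bij (fun e _ => (e : Sym2 (Fin N))) ?_ ?_ ?_ ?_
  · intro e he
    exact (hT _).2 (Finset.mem_filter.1 he).2
  · intro a _ b _ h
    exact Subtype.ext h
  · intro e he
    have he' := (hT e).1 he
    exact ⟨⟨e, H.edgeSet_subset he'⟩, Finset.mem_filter.2 ⟨Finset.mem_univ _, he'⟩, rfl⟩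
  · intro e _
    rfl

theorem pairing_walk {G : SimpleGraph (Fin N)} (y : Sym2 (Fin N) → ZMod 2) {v : Fin N}
    (p : G.Walk v v) (hp : p.IsCycle) :
    pairing G y (incidenceVector p.toSubgraph) = walkSum y p := by
  classical
  rw [pairing_incidenceVector y p.toSubgraph p.edges.toFinset fun e => by
    rw [List.mem_toFinset, Walk.mem_edges_toSubgraph]]
  exact List.sum_toFinset y hp.isTrail.edges_nodup

/-- Coboundaries vanish on even subgraphs. -/
theorem pairing_eq_zero_of_potential {G : SimpleGraph (Fin N)} (y : Sym2 (Fin N) → ZMod 2)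
    (d : Fin N → ZMod 2) (hd : ∀ u v, G.Adj u v → y s(u, v) = d u + d v) {H : G.Subgraph}
    (hH : IsEvenSubgraph H) : pairing G y (incidenceVector H) = 0 := by
  classical
  rw [pairing_incidenceVector y H H.spanningCoe.edgeFinset fun e => by simp]
  have hye : ∀ e ∈ H.spanningCoe.edgeFinset, y e = ∑ w, if w ∈ e then d w else 0 := by
    intro e he
    induction e with
    | _ u v =>
      have hadj : H.Adj u v := by simpa using he
      have huv : u ≠ v := hadj.ne
      rw [hd u v hadj.adj_sub, ← Finset.sum_filter]
      have : (Finset.univ.filter fun w => w ∈ s(u, v)) = {u, v} := by ext; simp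
      rw [this, Finset.sum_pair huv]
  -- After exchanging the sums, `d w` occurs once for each edge at `w`, an even number of times.
  rw [Finset.sum_congr rfl hye, Finset.sum_comm]
  refine Finset.sum_eq_zero fun w _ => ?_
  rw [← Finset.sum_filter, Finset.sum_const, ← SimpleGraph.incidenceFinset_eq_filter,
    SimpleGraph.card_incidenceFinset_eq_degree]
  have hdeg : H.spanningCoe.degree w = (H.neighborSet w).ncard := by
    rw [← SimpleGraph.card_neighborSet_eq_degree, ← Nat.card_eq_fintype_card]
    rfl
  obtain ⟨k, hk⟩ := hH.2 w
  rw [hdeg, hk, add_smul, CharTwo.add_self_eq_zero]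

theorem isEvenSubgraph_of_isCycle {G : SimpleGraph (Fin N)} {v : Fin N} {p : G.Walk v v}
    (hp : p.IsCycle) : IsEvenSubgraph p.toSubgraph := by
  refine ⟨p.toSubgraph_connected, fun w => ?_⟩
  by_cases hw : w ∈ p.support
  · rw [hp.ncard_neighborSet_toSubgraph_eq_two hw]
    exact even_two
  · have : p.toSubgraph.neighborSet w = ∅ := by
      ext x
      simp only [Subgraph.mem_neighborSet, Set.mem_empty_iff_false, iff_false]
      exact fun h => hw (Walk.mem_support_of_adj_toSubgraph h)
    simp [this]

theorem incidenceVector_mem_cycleSpace {G : SimpleGraph (Fin N)} {v : Fin N} {p : G.Walk v v}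
    (hp : p.IsCycle) : incidenceVector p.toSubgraph ∈ cycleSpace G :=
  Submodule.subset_span ⟨_, isEvenSubgraph_of_isCycle hp, rfl⟩

/-! ### The two implications -/

/-- Changing signs according to a labelling that vanishes on all short induced cycles preserves
the small principal minors. -/
theorem principalMinor_eq_of_walkSum_eq_zero {K K' : Matrix (Fin N) (Fin N) ℝ} (hK : K.IsSymm)
    (y : Sym2 (Fin N) → ZMod 2) (hy : ∀ i j, K' i j = sgn (y s(i, j)) * K i j)
    (hdiag : ∀ i, y s(i, i) = 0) (S : Finset (Fin N))
    (hsum : ∀ (v : Fin N) (p : (inducedGraph K).Walk v v), p.IsCycle → p.toSubgraph.IsInduced →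
      p.length ≤ S.card → walkSum y p = 0) :
    principalMinor K' S = principalMinor K S := by
  obtain ⟨d, hd⟩ := exists_potential_on y S hsum
  have : K'.submatrix (Subtype.val : S → Fin N) (Subtype.val : S → Fin N) =
      Matrix.diagonal (fun i : S => sgn (d i)) *
        K.submatrix (Subtype.val : S → Fin N) (Subtype.val : S → Fin N) *
        Matrix.diagonal (fun i : S => sgn (d i)) := by
    ext i j
    rw [Matrix.mul_diagonal, Matrix.diagonal_mul, Matrix.submatrix_apply, Matrix.submatrix_apply, hy]
    by_cases hij : (i : Fin N) = j
    · rw [hij, hdiag, sgn_zero]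
      linear_combination (-K j j) * sgn_mul_self (d j)
    · by_cases h0 : K i j = 0
      · simp [h0]
      · rw [hd i i.2 j j.2 ((inducedGraph_adj hK).2 ⟨hij, h0⟩), sgn_add]
        ring
  rw [principalMinor, this, det_diagonal_conj, principalMinor]

/-- If the short induced cycles did not span, some functional would kill them but not an even
subgraph. Flipping signs by it preserves the small minors, so it must be a coboundary, which kills
every even subgraph. -/
theorem hasInducedCycleBasis_of_determined {K : Matrix (Fin N) (Fin N) ℝ} (hK : K.IsSymm) {l : ℕ}
    (hdet : DeterminedByMinors K l) : HasInducedCycleBasis (inducedGraph K) l := by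
  classical
  set G := inducedGraph K with hG
  let T : Set (G.edgeSet → ZMod 2) := {x | IsInducedCycleVector G l x}
  suffices h : Submodule.span (ZMod 2) T = cycleSpace G by
    obtain ⟨B, hBT, hspan, hli⟩ := exists_linearIndependent (ZMod 2) T
    exact ⟨B, fun x hx => hBT hx, hli, hspan.trans h⟩
  refine le_antisymm (Submodule.span_le.2 ?_) (Submodule.span_le.2 ?_)
  · rintro x ⟨v, p, hp, -, -, rfl⟩
    exact incidenceVector_mem_cycleSpace hp
  rintro x ⟨H, hH, rfl⟩
  by_contra hx
  obtain ⟨f, hfx, hf⟩ := Submodule.exists_le_ker_of_notMem hx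
  let y : Sym2 (Fin N) → ZMod 2 := fun e =>
    if h : e ∈ G.edgeSet then f (Pi.single ⟨e, h⟩ 1) else 0
  have hfy : f = pairing G y := by
    ext e
    have hye : y e = f (Pi.single e 1) := by simp [y]
    simp [pairing, hye, Pi.single_apply]
  have hdiag : ∀ i, y s(i, i) = 0 := fun i => by simp [y]
  have hwalk : ∀ (v : Fin N) (p : G.Walk v v), p.IsCycle → p.toSubgraph.IsInduced →
      p.length ≤ l → walkSum y p = 0 := by
    intro v p hp hind hpl
    rw [← pairing_walk y p hp, ← hfy]
    exact hf (Submodule.subset_span ⟨v, p, hp, hind, hpl, rfl⟩)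
  let K' : Matrix (Fin N) (Fin N) ℝ := Matrix.of fun i j => sgn (y s(i, j)) * K i j
  have hK' : K'.IsSymm := by
    ext i j
    simp only [K', Matrix.transpose_apply, Matrix.of_apply]
    rw [hK.apply, Sym2.eq_swap]
  obtain ⟨D, ⟨d, hd, rfl⟩, hD⟩ := hdet K' hK' fun S hS =>
    principalMinor_eq_of_walkSum_eq_zero hK y (fun _ _ => rfl) hdiag S
      fun v p hp hind hpS => hwalk v p hp hind (hpS.trans hS)
  choose δ hδ using fun i => exists_sgn_eq (hd i)
  apply hfx
  rw [hfy]
  refine pairing_eq_zero_of_potential y δ (fun u v huv => sgn_injective ?_) hH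
  have huv' := ((inducedGraph_adj hK).1 huv).2
  have h := congrFun (congrFun hD u) v
  rw [Matrix.mul_diagonal, Matrix.diagonal_mul] at h
  rw [sgn_add, hδ, hδ]
  apply mul_right_cancel₀ huv'
  calc sgn (y s(u, v)) * K u v = K' u v := rfl
    _ = d u * d v * K u v := by rw [h]; ring

theorem sq_eq_sq_of_minors {K K' : Matrix (Fin N) (Fin N) ℝ} (hK : K.IsSymm) (hK' : K'.IsSymm)
    (h : ∀ S : Finset (Fin N), S.card ≤ 2 → principalMinor K' S = principalMinor K S) :
    (∀ i, K' i i = K i i) ∧ ∀ i j, K' i j ^ 2 = K i j ^ 2 := by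
  have hd : ∀ i, K' i i = K i i := by
    intro i
    have hc : Function.Injective (fun _ : Fin 1 => i) := fun a b _ => Subsingleton.elim a b
    have := h _ (Finset.card_image_le.trans (by simp) :
      (Finset.univ.image (fun _ : Fin 1 => i)).card ≤ 2)
    rw [principalMinor_image _ _ hc, principalMinor_image _ _ hc] at this
    simpa using this
  refine ⟨hd, fun i j => ?_⟩
  by_cases hij : i = j
  · rw [hij, hd]
  · have hc : Function.Injective ![i, j] := by
      intro a b
      fin_cases a <;> fin_cases b <;> simp [hij, Ne.symm hij]
    have := h _ (Finset.card_image_le.trans (by simp) : (Finset.univ.image ![i, j]).card ≤ 2)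
    rw [principalMinor_image _ _ hc, principalMinor_image _ _ hc, Matrix.det_fin_two,
      Matrix.det_fin_two] at this
    simp only [Matrix.submatrix_apply, Matrix.cons_val_zero, Matrix.cons_val_one, hd,
      hK.apply i j, hK'.apply i j] at this
    linarith

/-- The dual form `hspan` of spanning is all that is needed: it carries the vanishing of `y` from
short induced cycles to all cycles, and a potential for `y` gives `D`. -/
theorem determined_of_pairing {K : Matrix (Fin N) (Fin N) ℝ} (hK : K.IsSymm) {l : ℕ} (hl : 2 ≤ l)
    (hspan : ∀ y, (∀ x, IsInducedCycleVector (inducedGraph K) l x →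
      pairing (inducedGraph K) y x = 0) → ∀ x ∈ cycleSpace (inducedGraph K),
        pairing (inducedGraph K) y x = 0) :
    DeterminedByMinors K l := by
  classical
  intro K' hK' hminor
  obtain ⟨hd, hsq⟩ := sq_eq_sq_of_minors hK hK' fun S hS => hminor S (hS.trans hl)
  let y : Sym2 (Fin N) → ZMod 2 := Sym2.lift ⟨fun i j => if K' i j = K i j then 0 else 1,
    fun i j => by simp only [hK.apply i j, hK'.apply i j]⟩
  have hy : ∀ i j, K' i j = sgn (y s(i, j)) * K i j := by
    intro i j
    by_cases h : K' i j = K i j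
    · simp [y, h]
    · have h' := (sq_eq_sq_iff_eq_or_eq_neg.1 (hsq i j)).resolve_left h
      simp only [y, Sym2.lift_mk, h, if_false, sgn_one]
      rw [h']; ring
  have hdiag : ∀ i, y s(i, i) = 0 := fun i => by simp [y, hd]
  have hcyc := hspan y (by
    rintro x ⟨v, p, hp, hind, hpl, rfl⟩
    rw [pairing_walk y p hp]
    exact walkSum_eq_zero_of_minor_eq hK y hy hdiag p hp hind
      fun S hS => hminor S (hS.trans hpl))
  obtain ⟨d, hd'⟩ := exists_potential y (walkSum_eq_zero_of_induced_cycles y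
    fun v (p : (inducedGraph K).Walk v v) hp _ => by
      rw [← pairing_walk y p hp]
      exact hcyc _ (incidenceVector_mem_cycleSpace hp))
  refine ⟨_, ⟨fun i => sgn (d i), fun i => sgn_eq_one_or _, rfl⟩, ?_⟩
  ext i j
  rw [Matrix.mul_diagonal, Matrix.diagonal_mul, hy]
  by_cases hij : i = j
  · rw [hij, hdiag, sgn_zero]
    linear_combination (-K j j) * sgn_mul_self (d j)
  · by_cases h0 : K i j = 0
    · simp [h0]
    · rw [hd' i j ((inducedGraph_adj hK).2 ⟨hij, h0⟩), sgn_add]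
      ring

theorem pairing_eq_zero_of_cycleSparsity_le {G : SimpleGraph (Fin N)} {l : ℕ}
    (h : cycleSparsity G ≤ l) (y : Sym2 (Fin N) → ZMod 2)
    (hy : ∀ x, IsInducedCycleVector G l x → pairing G y x = 0) :
    ∀ x ∈ cycleSpace G, pairing G y x = 0 := by
  intro x hx
  rw [cycleSparsity] at h
  split_ifs at h with h0
  · rw [h0, Submodule.mem_bot] at hx
    rw [hx, map_zero]
  -- The strict bound by `l + 1` yields a witness `l' ≤ l` without showing that the infimum is
  -- attained.
  · have hlt : (⨅ (l : ℕ) (_ : HasInducedCycleBasis G l), (l : ℕ∞)) < ((l + 1 : ℕ) : ℕ∞) :=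
      h.trans_lt (by exact_mod_cast Nat.lt_succ_self l)
    obtain ⟨l', hl'⟩ := iInf_lt_iff.1 hlt
    obtain ⟨⟨B, hB, -, hspan⟩, hll⟩ := iInf_lt_iff.1 hl'
    have hll' : l' ≤ l := Nat.lt_succ_iff.1 (by exact_mod_cast hll)
    rw [← hspan] at hx
    refine (Submodule.span_le.2 ?_ : Submodule.span (ZMod 2) B ≤ LinearMap.ker (pairing G y)) hx
    intro b hb
    obtain ⟨v, p, hp, hind, hpl, rfl⟩ := hB b hb
    exact hy _ ⟨v, p, hp, hind, hpl.trans hll', rfl⟩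

end CycleSparsity

theorem mainTheorem3 (N : ℕ) (K : Matrix (Fin N) (Fin N) ℝ) (hK : K.IsSymm) (l : ℕ)
    (hl : 3 ≤ l) :
    CycleSparsity.DeterminedByMinors K l ↔
      CycleSparsity.cycleSparsity (CycleSparsity.inducedGraph K) ≤ (l : ℕ∞) := by
  constructor
  · intro h
    rw [CycleSparsity.cycleSparsity]
    split_ifs
    · exact_mod_cast (by omega : 2 ≤ l)
    · exact iInf₂_le l (CycleSparsity.hasInducedCycleBasis_of_determined hK h)
  · intro h
    exact CycleSparsity.determined_of_pairing hK (by omega)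
      (CycleSparsity.pairing_eq_zero_of_cycleSparsity_le h)
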